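/- All graphs are finite and simple. A graph is factorizable if it has a perfect matching. Let $G$ be a factorizable graph. An edge of $G$ is allowed if it lies in some perfect matching of $G$; for each connected component $C$ of the subgraph of $G$ formed by all allowed edges, the induced subgraph $G[V(C)]$ is called a factor-component of $G$, and $\mathcal{G}(G)$ denotes the set of all factor-components of $G$. A set $X\subseteq V(G)$ is separating if for every $H\in\mathcal{G}(G)$ either $V(H)\subseteq X$ or $V(H)\cap X=\emptyset$. A graph is factor-critical if deleting any single vertex leaves a factorizable graph (the graph with no vertices counts as factorizable). For $G_1,G_2\in\mathcal{G}(G)$ write $G_1\trianglelefteq G_2$ if there is a separating set $X$ with $V(G_1)\cup V(G_2)\subseteq X$ such that $G[X]/G_1$, the graph obtained from $G[X]$ by contracting all edges of $G_1$, is factor-critical. **Theorem.** Let $G$ be a factorizable graph, and let $G_1,G_2\in\mathcal{G}(G)$ be such that $G_1\trianglelefteq G_2$ does not hold and $G_1$ is minimal in $\mathcal{G}(G)$ with respect to $\trianglelefteq$, that is, $H\trianglelefteq G_1$ with $H\in\mathcal{G}(G)$ implies $H=G_1$. Then there are possibly identical edges $e,f$ of the complement of $G$, each joining a vertex of $G_1$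 to a vertex of $G_2$, such that $\mathcal{G}(G+e+f)=\mathcal{G}(G)$ and $G_1\trianglelefteq G_2$ holds with respect to the graph $G+e+f$, where $G+e+f$ is the graph obtained from $G$ by adding the edges $e$ and $f$. -/

import Mathlib

namespace FactorPoset

/-- `G` has a perfect matching. -/
def IsFactorizable {V : Type*} (G : SimpleGraph V) : Prop :=
  ∃ M : G.Subgraph, M.IsPerfectMatching

/-- The graph on `V` whose edges are the allowed edges of `G`, i.e. those contained in some
perfect matching of `G`. (If `G` is factorizable, every vertex lies on an allowed edge.) -/
def allowedGraph {V : Type*} (G : SimpleGraph V) : SimpleGraph V where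
  Adj u v := ∃ M : G.Subgraph, M.IsPerfectMatching ∧ M.Adj u v
  symm := ⟨fun _ _ ⟨M, hM, h⟩ => ⟨M, hM, h.symm⟩⟩
  loopless := ⟨fun _ ⟨M, _, h⟩ => M.loopless.irrefl _ h⟩

/-- The induced subgraph `G[X]`, as a graph with vertex set `X`. A graph whose vertex set is a
subset of `V` is a subgraph of the complete graph on `V`, so that such graphs can be compared
also when they come from different graphs on `V`. -/
def inducedOn {V : Type*} (G : SimpleGraph V) (X : Set V) : (⊤ : SimpleGraph V).Subgraph where
  verts := X
  Adj u v := u ∈ X ∧ v ∈ X ∧ G.Adj u v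
  adj_sub h := h.2.2.ne
  edge_vert h := h.1
  symm := ⟨fun _ _ h => ⟨h.2.1, h.1, h.2.2.symm⟩⟩

/-- The set of all factor-components of `G`: the subgraphs of `G` induced by the vertex sets of
the connected components of the graph of allowed edges. -/
def factorComponents {V : Type*} (G : SimpleGraph V) : Set ((⊤ : SimpleGraph V).Subgraph) :=
  {H | ∃ C : (allowedGraph G).ConnectedComponent, H = inducedOn G C.supp}

/-- Deleting any single vertex leaves a factorizable graph. -/
def IsFactorCritical {W : Type*} (G : SimpleGraph W) : Prop :=
  ∀ w : W, IsFactorizable (G.induce ({w}ᶜ : Set W))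

/-- The contraction of `G` by the edges of `F`: the vertices joined by paths in `F` are identified.
Loops and parallel edges that arise are dropped (they do not matter for perfect matchings). -/
def contraction {W : Type*} (G F : SimpleGraph W) : SimpleGraph F.ConnectedComponent :=
  G.map F.connectedComponentMk

/-- `X` is a union of vertex sets of factor-components. -/
def IsSeparating {V : Type*} (G : SimpleGraph V) (X : Set V) : Prop :=
  ∀ H ∈ factorComponents G, H.verts ⊆ X ∨ Disjoint H.verts X

/-- `X` is a critical-inducing set for `G₁` to `G₂`: it is separating, it contains the vertices of
`G₁` and `G₂`, and `G[X] / G₁` is factor-critical. -/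
def IsCriticalInducing {V : Type*} (G : SimpleGraph V) (G₁ G₂ : (⊤ : SimpleGraph V).Subgraph)
    (X : Set V) : Prop :=
  IsSeparating G X ∧ G₁.verts ∪ G₂.verts ⊆ X ∧
    IsFactorCritical (contraction (G.induce X) (G₁.spanningCoe.induce X))

/-- The relation `G₁ ⊴ G₂` between factor-components of `G`. -/
def Yields {V : Type*} (G : SimpleGraph V) (G₁ G₂ : (⊤ : SimpleGraph V).Subgraph) : Prop :=
  G₁ ∈ factorComponents G ∧ G₂ ∈ factorComponents G ∧ ∃ X : Set V, IsCriticalInducing G G₁ G₂ X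

/-- `G₁` is a minimal factor-component with respect to `⊴`. -/
def IsMinimalComponent {V : Type*} (G : SimpleGraph V)
    (G₁ : (⊤ : SimpleGraph V).Subgraph) : Prop :=
  G₁ ∈ factorComponents G ∧ ∀ H ∈ factorComponents G, Yields G H G₁ → H = G₁

end FactorPoset

namespace FactorPoset

/-! Minimality of G₁ supplies a vertex x of G₁ such that G − x − y has no perfect matching for any y
in G₂. Joining x to vertices of G₂ then creates no perfect matching: all new edges meet at x, so a
matching contains at most one of them, and the rest of it would match G − x − y. Now let y, f y be a
matched pair in G₂. Once x is adjacent to both, G₂ together with x is factor-critical, which gives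
G₁ ⊴ G₂ through V(G₁) ∪ V(G₂) (`yields_of_adj`). Since G₁ ⊴ G₂ fails in G, the two edges are not
both present already.

The vertex x comes from `exists_yields_of_matchable`. If every x in G₁ had a partner y in G₂ with G
− x − y factorizable, contract G₂ to a vertex and take a Gallai–Edmonds barrier of the result. It
avoids G₁, so G₁ lies in a single factor-critical part K. If K contains the contracted vertex, then
G₂ ⊴ G₁. Otherwise every perfect matching leaves K by exactly one edge, and the component of that
edge is below G₁. Either way G₁ is not minimal.

Both facts rest on `exists_isCriticalBarrier` and `IsCriticalBarrier.exits`. -/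

/-- `f` restricts to a perfect matching of the subgraph of `G` induced by `Z`. -/
def MatchedBy {V : Type*} (G : SimpleGraph V) (f : V → V) (Z : Set V) : Prop :=
  ∀ v ∈ Z, f v ∈ Z ∧ f (f v) = v ∧ G.Adj v (f v)

/-- The subgraph of `G` induced by `Z` has a perfect matching. -/
def Matchable {V : Type*} (G : SimpleGraph V) (Z : Set V) : Prop :=
  ∃ f : V → V, MatchedBy G f Z

/-! ### Perfect matchings as involutions; alternating paths. -/

section Matching

variable {V W : Type*} {G H : SimpleGraph V} {f : V → V} {Z : Set V}

theorem MatchedBy.mono (h : MatchedBy G f Z) (hadj : ∀ a ∈ Z, ∀ b ∈ Z, G.Adj a b → H.Adj a b) :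
    MatchedBy H f Z := fun v hv =>
  ⟨(h v hv).1, (h v hv).2.1, hadj v hv _ (h v hv).1 (h v hv).2.2⟩

theorem Matchable.mono (h : Matchable G Z) (hadj : ∀ a ∈ Z, ∀ b ∈ Z, G.Adj a b → H.Adj a b) :
    Matchable H Z := h.imp fun _ hf => hf.mono hadj

theorem MatchedBy.restrict (h : MatchedBy G f Z) {Z' : Set V} (hZ : Z' ⊆ Z)
    (hf : ∀ v ∈ Z', f v ∈ Z') : MatchedBy G f Z' := fun v hv =>
  ⟨hf v hv, (h v (hZ hv)).2⟩

theorem MatchedBy.eq_of_apply_eq (h : MatchedBy G f Z) {a b : V} (ha : a ∈ Z) (hb : b ∈ Z)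
    (hab : f a = f b) : a = b := by
  rw [← (h a ha).2.1, hab, (h b hb).2.1]

theorem MatchedBy.diff (h : MatchedBy G f Z) {T : Set V} (hT : ∀ v ∈ T, f v ∈ T) : MatchedBy G f (Z \ T) := by
  refine h.restrict Set.sdiff_subset fun v hv => ⟨(h v hv.1).1, fun hvT => hv.2 ?_⟩
  rw [← (h v hv.1).2.1]
  exact hT _ hvT

theorem MatchedBy.diff_pair (h : MatchedBy G f Z) {a : V} (ha : a ∈ Z) :
    MatchedBy G f (Z \ {a, f a}) := by
  refine h.diff ?_
  rintro v (rfl | rfl)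
  · simp
  · simp [(h a ha).2.1]

theorem Matchable.insert_pair (h : Matchable G Z) {a b : V} (ha : a ∉ Z) (hb : b ∉ Z)
    (hab : G.Adj a b) : Matchable G (insert a (insert b Z)) := by
  classical
  obtain ⟨f, hf⟩ := h
  refine ⟨fun v => if v = a then b else if v = b then a else f v, ?_⟩
  have hne : b ≠ a := hab.ne'
  rintro v (rfl | rfl | hv)
  · simp [hne, hab]
  · simp [hne, hab.symm]
  · have h1 : v ≠ a := fun h => ha (h ▸ hv)
    have h2 : v ≠ b := fun h => hb (h ▸ hv)
    obtain ⟨h3, h4, h5⟩ := hf v hv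
    have h6 : f v ≠ a := fun h => ha (h ▸ h3)
    have h7 : f v ≠ b := fun h => hb (h ▸ h3)
    simp [h1, h2, h3, h4, h5, h6, h7]

/-- Injectivity is needed on `Z` only: a contraction map is injective on any set with at most one
vertex in the contracted component. -/
theorem Matchable.image (h : Matchable G Z) {K : SimpleGraph W} (φ : V → W) (hφ : Set.InjOn φ Z)
    (hadj : ∀ a ∈ Z, ∀ b ∈ Z, G.Adj a b → K.Adj (φ a) (φ b)) : Matchable K (φ '' Z) := by
  classical
  obtain ⟨f, hf⟩ := h
  rcases isEmpty_or_nonempty V with hV | hV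
  · exact ⟨id, by rintro _ ⟨v, -⟩; exact (hV.false v).elim⟩
  refine ⟨fun w => φ (f (Function.invFunOn φ Z w)), ?_⟩
  rintro _ ⟨v, hv, rfl⟩
  obtain ⟨h1, h2, h3⟩ := hf v hv
  have key : ∀ u ∈ Z, Function.invFunOn φ Z (φ u) = u := fun u hu =>
    hφ.leftInvOn_invFunOn hu
  simp only [key v hv, key _ h1, h2]
  exact ⟨⟨_, h1, rfl⟩, trivial, hadj _ hv _ h1 h3⟩

theorem Matchable.even_ncard (h : Matchable G Z) (hZ : Z.Finite) : Even Z.ncard := by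
  classical
  obtain ⟨f, hf⟩ := h
  rw [Set.ncard_eq_toFinset_card Z hZ, even_iff_two_dvd, ← ZMod.natCast_eq_zero_iff,
    Finset.cast_card]
  -- Modulo 2 the ones summed over `Z` cancel in pairs under the fixed-point-free involution.
  refine Finset.sum_involution (fun v _ => f v) ?_ ?_ ?_ ?_
  · intros; decide
  · intro a ha _
    exact ((hf a (by simpa using ha)).2.2).ne'
  · intro a ha
    simpa using (hf a (by simpa using ha)).1
  · intro a ha
    exact (hf a (by simpa using ha)).2.1

theorem exists_isPerfectMatching_of_matchedBy (h : MatchedBy G f Set.univ) :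
    ∃ M : G.Subgraph, M.IsPerfectMatching ∧ ∀ a b, M.Adj a b ↔ f a = b := by
  refine ⟨{ verts := Set.univ, Adj := fun a b => f a = b, adj_sub := ?_, edge_vert := ?_,
            symm := ⟨?_⟩ }, ?_, fun a b => Iff.rfl⟩
  · rintro a _ rfl
    exact (h a trivial).2.2
  · intros; trivial
  · rintro a _ rfl
    exact (h a trivial).2.1
  · rw [SimpleGraph.Subgraph.isPerfectMatching_iff]
    exact fun v => ⟨f v, rfl, fun w (hw : f v = w) => hw.symm⟩

theorem exists_matchedBy_of_isPerfectMatching {M : G.Subgraph} (hM : M.IsPerfectMatching) :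
    ∃ f, MatchedBy G f Set.univ ∧ ∀ a b, M.Adj a b ↔ f a = b := by
  rw [SimpleGraph.Subgraph.isPerfectMatching_iff] at hM
  choose f hf hu using hM
  have key : ∀ a b, M.Adj a b ↔ f a = b := fun a b =>
    ⟨fun h => (hu a b h).symm, fun h => h ▸ hf a⟩
  exact ⟨f, fun v _ => ⟨trivial, (key _ _).1 (hf v).symm, (hf v).adj_sub⟩, key⟩

theorem isFactorizable_iff : IsFactorizable G ↔ ∃ f, MatchedBy G f Set.univ := by
  constructor
  · rintro ⟨M, hM⟩
    obtain ⟨f, hf, -⟩ := exists_matchedBy_of_isPerfectMatching hM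
    exact ⟨f, hf⟩
  · rintro ⟨f, hf⟩
    obtain ⟨M, hM, -⟩ := exists_isPerfectMatching_of_matchedBy hf
    exact ⟨M, hM⟩

theorem allowedGraph_adj_iff {u v : V} :
    (allowedGraph G).Adj u v ↔ ∃ f, MatchedBy G f Set.univ ∧ f u = v := by
  constructor
  · rintro ⟨M, hM, h⟩
    obtain ⟨f, hf, hf'⟩ := exists_matchedBy_of_isPerfectMatching hM
    exact ⟨f, hf, (hf' _ _).1 h⟩
  · rintro ⟨f, hf, h⟩
    obtain ⟨M, hM, hM'⟩ := exists_isPerfectMatching_of_matchedBy hf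
    exact ⟨M, hM, (hM' _ _).2 h⟩

theorem isFactorizable_induce_iff : IsFactorizable (G.induce Z) ↔ Matchable G Z := by
  classical
  rw [isFactorizable_iff]
  constructor
  · rintro ⟨f, hf⟩
    have : Matchable G (Subtype.val '' (Set.univ : Set Z)) :=
      Matchable.image ⟨f, hf⟩ Subtype.val Subtype.val_injective.injOn fun a _ b _ h => h
    simpa using this
  · rintro ⟨f, hf⟩
    refine ⟨fun v => ⟨f v, (hf v v.2).1⟩, fun v _ => ⟨trivial, ?_, (hf v v.2).2.2⟩⟩
    exact Subtype.ext (hf v v.2).2.1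

/-- Given perfect matchings of `Y` and of `(Y ∪ T) \ {v}`, follow the alternating path from `v`
until it enters `T`. -/
theorem exists_matchable_insert_diff [Finite V] {Y T : Set V} (hYT : Disjoint Y T) {v : V}
    (hv : v ∈ Y) (hY : Matchable G Y) (hN : Matchable G ((Y ∪ T) \ {v})) :
    ∃ t ∈ T, Matchable G (insert t Y \ {v}) := by
  obtain ⟨M, hM⟩ := hY
  obtain ⟨N, hN⟩ := hN
  induction hn : Y.ncard using Nat.strong_induction_on generalizing Y v with
  | _ n ih =>
  obtain ⟨haY, hav, hadj⟩ := hM v hv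
  have hav' : M v ≠ v := hadj.ne'
  obtain ⟨hb, hb', hab⟩ := hN (M v) ⟨Or.inl haY, hav'⟩
  have hdisj : ∀ t ∈ T, t ∉ Y := fun t ht hY => Set.disjoint_left.1 hYT hY ht
  have hbv : N (M v) ≠ v := hb.2
  -- The path runs from `v` to `M v` to `N (M v)`. If it is still in `Y`, remove the used pair from
  -- each matching and continue from `N (M v)`.
  rcases hb.1 with hbY | hbT
  · have hlt : (Y \ {v, M v}).ncard < n := by
      rw [← hn]
      exact Set.ncard_lt_ncard ⟨Set.sdiff_subset, fun h => (h hv).2 (by simp)⟩ (Set.toFinite _)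
    have hset : ((Y \ {v, M v} ∪ T) \ {N (M v)}) = ((Y ∪ T) \ {v}) \ {M v, N (M v)} := by
      ext z
      have := hdisj z
      simp only [Set.mem_sdiff, Set.mem_union, Set.mem_insert_iff, Set.mem_singleton_iff]
      constructor
      · rintro ⟨⟨h1, h2⟩ | h1, h3⟩
        · tauto
        · have h4 : z ≠ v := fun h => this h1 (h ▸ hv)
          have h5 : z ≠ M v := fun h => this h1 (h ▸ haY)
          tauto
      · tauto
    obtain ⟨t, ht, hmt⟩ := ih _ hlt (hYT.mono_left Set.sdiff_subset)
      (v := N (M v)) ⟨hbY, by simp [hbv, hab.ne']⟩ (hM.diff_pair hv)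
      (hset ▸ hN.diff_pair ⟨Or.inl haY, hav'⟩) rfl
    refine ⟨t, ht, ?_⟩
    have htY := hdisj t ht
    have htv : t ≠ v := fun h => htY (h ▸ hv)
    have hta : t ≠ M v := fun h => htY (h ▸ haY)
    have := hmt.insert_pair (a := M v) (b := N (M v)) (by simp [hta.symm]) (by simp) hab
    convert this using 1
    ext z
    simp only [Set.mem_sdiff, Set.mem_insert_iff, Set.mem_singleton_iff]
    constructor
    · tauto
    · rintro (rfl | rfl | h)
      · exact ⟨Or.inr haY, hav'⟩
      · exact ⟨Or.inr hbY, hbv⟩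
      · rcases h with ⟨rfl | h, _⟩ <;> tauto
  · refine ⟨_, hbT, ?_⟩
    have := Matchable.insert_pair ⟨M, hM.diff_pair hv⟩ (a := M v) (b := N (M v)) (by simp)
      (fun h => hdisj _ hbT h.1) hab
    convert this using 1
    ext z
    simp only [Set.mem_sdiff, Set.mem_insert_iff, Set.mem_singleton_iff]
    constructor
    · tauto
    · rintro (rfl | rfl | h)
      · exact ⟨Or.inr haY, hav'⟩
      · exact ⟨Or.inl rfl, hbv⟩
      · tauto

end Matching

/-! ### Tutte's theorem and Gallai–Edmonds barriers. -/

/-- `𝒦` is a family of disjoint odd subsets of `Y \ B`, none of which is joined by an edge of `G`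
to the rest of `Y \ B`. -/
structure OddFamily {V : Type*} (G : SimpleGraph V) (Y B : Set V) (𝒦 : Set (Set V)) : Prop where
  subset : ∀ K ∈ 𝒦, K ⊆ Y \ B
  odd : ∀ K ∈ 𝒦, Odd K.ncard
  eq_of_mem : ∀ K ∈ 𝒦, ∀ L ∈ 𝒦, ∀ a ∈ K, a ∈ L → K = L
  mem_of_adj : ∀ K ∈ 𝒦, ∀ a ∈ K, ∀ b ∈ Y \ B, G.Adj a b → b ∈ K

theorem OddFamily.mono {V : Type*} {G : SimpleGraph V} {Y B : Set V} {𝒦 ℒ : Set (Set V)}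
    (h : OddFamily G Y B 𝒦) (hℒ : ℒ ⊆ 𝒦) : OddFamily G Y B ℒ :=
  ⟨fun K hK => h.subset K (hℒ hK), fun K hK => h.odd K (hℒ hK),
    fun K hK L hL => h.eq_of_mem K (hℒ hK) L (hℒ hL), fun K hK => h.mem_of_adj K (hℒ hK)⟩

section Tutte

variable {V : Type*} [Finite V] {G : SimpleGraph V} {f : V → V} {Y B : Set V} {𝒦 : Set (Set V)}

theorem exists_oddFamily_of_not_matchable (h : ¬ Matchable G Y) :
    ∃ S ⊆ Y, ∃ 𝒦, OddFamily G Y S 𝒦 ∧ S.ncard < 𝒦.ncard := by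
  classical
  rw [← isFactorizable_induce_iff, IsFactorizable, SimpleGraph.tutte] at h
  push Not at h
  obtain ⟨u, hu⟩ := h
  let ι : ((⊤ : (G.induce Y).Subgraph).deleteVerts u).verts → V := fun x => x.1.1
  have hι : Function.Injective ι := Subtype.val_injective.comp Subtype.val_injective
  have hinj : Function.Injective
      fun c : ((⊤ : (G.induce Y).Subgraph).deleteVerts u).coe.ConnectedComponent =>
        ι '' c.supp := by
    intro c d hcd
    exact SimpleGraph.ConnectedComponent.supp_injective (hι.image_injective hcd)
  refine ⟨Subtype.val '' u, by simp, (fun c => ι '' c.supp) ''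
    ((⊤ : (G.induce Y).Subgraph).deleteVerts u).coe.oddComponents, ⟨?_, ?_, ?_, ?_⟩, ?_⟩
  · rintro _ ⟨c, -, rfl⟩ _ ⟨x, -, rfl⟩
    refine ⟨x.1.2, ?_⟩
    rintro ⟨y, hy, hyx⟩
    have : y = x.1 := Subtype.ext hyx
    exact x.2.2 (this ▸ hy)
  · rintro _ ⟨c, hc, rfl⟩
    rw [Set.ncard_image_of_injective _ hι]
    exact hc
  · rintro _ ⟨c, -, rfl⟩ _ ⟨d, -, rfl⟩ _ ⟨x, hx, rfl⟩ ⟨y, hy, hyx⟩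
    have := hι hyx
    subst this
    rw [SimpleGraph.ConnectedComponent.mem_supp_iff] at hx hy
    rw [← hx, ← hy]
  · rintro _ ⟨c, -, rfl⟩ _ ⟨x, hx, rfl⟩ b ⟨hbY, hbS⟩ hab
    have hbu : (⟨b, hbY⟩ : Y) ∉ u := fun h => hbS ⟨_, h, rfl⟩
    refine ⟨⟨⟨b, hbY⟩, ⟨trivial, hbu⟩⟩, ?_, rfl⟩
    rw [SimpleGraph.ConnectedComponent.mem_supp_iff] at hx ⊢
    rw [← hx]
    refine (SimpleGraph.ConnectedComponent.sound (SimpleGraph.Adj.reachable ?_)).symm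
    rw [SimpleGraph.Subgraph.coe_adj, SimpleGraph.Subgraph.deleteVerts_adj]
    exact ⟨trivial, x.2.2, trivial, hbu, hab⟩
  · rw [Set.ncard_image_of_injective _ Subtype.val_injective, Set.ncard_image_of_injective _ hinj]
    exact hu

theorem OddFamily.sUnion_ncard (h : OddFamily G Y B 𝒦) :
    (⋃₀ 𝒦).ncard % 2 = 𝒦.ncard % 2 := by
  induction 𝒦, Set.toFinite 𝒦 using Set.Finite.induction_on with
  | empty => simp
  | @insert K 𝒦 hK _ ih =>
    rw [Set.sUnion_insert, Set.ncard_insert_of_notMem hK, Set.ncard_union_eq]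
    · have h1 := ih (h.mono (Set.subset_insert _ _))
      have h2 := Nat.odd_iff.1 (h.odd K (Set.mem_insert _ _))
      omega
    · rw [Set.disjoint_left]
      rintro a ha ⟨L, hL, haL⟩
      exact hK (h.eq_of_mem K (Set.mem_insert _ _) L (Set.mem_insert_of_mem _ hL) a ha haL ▸ hL)

theorem OddFamily.rest_ncard (h : OddFamily G Y B 𝒦) (hB : B ⊆ Y) :
    (B.ncard + 𝒦.ncard + ((Y \ B) \ ⋃₀ 𝒦).ncard) % 2 = Y.ncard % 2 := by
  have h1 := h.sUnion_ncard
  have h2 := Set.ncard_sdiff_add_ncard_of_subset hB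
  have h3 := Set.ncard_sdiff_add_ncard_of_subset (Set.sUnion_subset h.subset)
  omega

/-- The rest of `Y \ B'` can be added to the family if it is odd. -/
theorem OddFamily.insert_rest (h : OddFamily G Y B 𝒦) {B' : Set V} (hB : B ⊆ B')
    (hodd : Odd (((Y \ B') \ ⋃₀ 𝒦).ncard)) (hB' : ∀ v ∈ B', v ∉ ⋃₀ 𝒦) :
    OddFamily G Y B' (insert ((Y \ B') \ ⋃₀ 𝒦) 𝒦) ∧
      (insert ((Y \ B') \ ⋃₀ 𝒦) 𝒦).ncard = 𝒦.ncard + 1 := by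
  have hsub : ∀ K ∈ 𝒦, K ⊆ Y \ B' := fun K hK a ha =>
    ⟨(h.subset K hK ha).1, fun h3 => hB' a h3 ⟨K, hK, ha⟩⟩
  have hsub' : Y \ B' ⊆ Y \ B := Set.sdiff_subset_sdiff_right hB
  refine ⟨⟨?_, ?_, ?_, ?_⟩, ?_⟩
  · rintro K (rfl | hK)
    · exact Set.sdiff_subset
    · exact hsub K hK
  · rintro K (rfl | hK)
    · exact hodd
    · exact h.odd K hK
  · rintro K (rfl | hK) L (rfl | hL) a haK haL
    · rfl
    · exact (haK.2 ⟨L, hL, haL⟩).elim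
    · exact (haL.2 ⟨K, hK, haK⟩).elim
    · exact h.eq_of_mem K hK L hL a haK haL
  · rintro K (rfl | hK) a ha b hb hab
    · refine ⟨hb, ?_⟩
      rintro ⟨L, hL, hbL⟩
      exact ha.2 ⟨L, hL, h.mem_of_adj L hL b hbL a (hsub' ha.1) hab.symm⟩
    · exact h.mem_of_adj K hK a ha b (hsub' hb) hab
  · refine Set.ncard_insert_of_notMem (fun hmem => ?_) (Set.toFinite _)
    obtain ⟨a, ha⟩ := (Set.ncard_pos (Set.toFinite _)).1 hodd.pos
    exact ha.2 ⟨_, hmem, ha⟩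

/-- By parity, an excess of exactly one forces the vertices outside `S` and the family to be odd in
number, so they form one more member. -/
theorem exists_oddFamily_of_not_matchable_of_even (h : ¬ Matchable G Y) (hY : Even Y.ncard) :
    ∃ S ⊆ Y, ∃ 𝒦, OddFamily G Y S 𝒦 ∧ S.ncard + 2 ≤ 𝒦.ncard := by
  obtain ⟨S, hS, 𝒦, h𝒦, hlt⟩ := exists_oddFamily_of_not_matchable h
  by_cases h2 : S.ncard + 2 ≤ 𝒦.ncard
  · exact ⟨S, hS, 𝒦, h𝒦, h2⟩
  · have h3 := h𝒦.rest_ncard hS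
    rw [Nat.even_iff] at hY
    obtain ⟨h4, h5⟩ := h𝒦.insert_rest subset_rfl (Nat.odd_iff.2 (by omega))
      (fun v hv ⟨K, hK, hvK⟩ => (h𝒦.subset K hK hvK).2 hv)
    exact ⟨S, hS, _, h4, by omega⟩

/-- A member that is not factor-critical can be refined. -/
theorem OddFamily.exists_refinement (h : OddFamily G Y B 𝒦) {K : Set V} (hK : K ∈ 𝒦) {v : V}
    (hv : v ∈ K) (hn : ¬ Matchable G (K \ {v})) :
    ∃ B' ⊆ Y \ B, B'.Nonempty ∧ ∃ ℒ, OddFamily G Y (B ∪ B') ℒ ∧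
      𝒦.ncard + B'.ncard ≤ ℒ.ncard := by
  have hcard := Set.ncard_sdiff_singleton_add_one hv (Set.toFinite K)
  have hKodd := Nat.odd_iff.1 (h.odd K hK)
  obtain ⟨S, hS, ℒ, hℒ, hle⟩ := exists_oddFamily_of_not_matchable_of_even hn
    (Nat.even_iff.2 (by omega))
  have hSK : insert v S ⊆ K := Set.insert_subset hv (hS.trans Set.sdiff_subset)
  have hℒK : ∀ L ∈ ℒ, L ⊆ K := fun L hL => (hℒ.subset L hL).trans
    (Set.sdiff_subset.trans Set.sdiff_subset)
  have hne : ∀ L ∈ 𝒦 \ {K}, ∀ a ∈ L, a ∉ K := fun L hL a haL haK =>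
    hL.2 (h.eq_of_mem L hL.1 K hK a haL haK)
  -- Replacing `K` by `ℒ` gains at least `S.ncard + 1` members, which pays for `v` and `S`; this is
  -- where the surplus of two is used.
  refine ⟨insert v S, hSK.trans (h.subset K hK), Set.insert_nonempty _ _, 𝒦 \ {K} ∪ ℒ,
    ⟨?_, ?_, ?_, ?_⟩, ?_⟩
  · rintro L (hL | hL) a ha
    · obtain ⟨h1, h2⟩ := h.subset L hL.1 ha
      exact ⟨h1, fun h3 => h3.elim h2 fun h4 => hne L hL a ha (hSK h4)⟩
    · obtain ⟨h1, h2⟩ := h.subset K hK (hℒK L hL ha)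
      obtain ⟨⟨-, h3⟩, h4⟩ := hℒ.subset L hL ha
      exact ⟨h1, fun h5 => h5.elim h2 fun h6 => h6.elim h3 h4⟩
  · rintro L (hL | hL)
    · exact h.odd L hL.1
    · exact hℒ.odd L hL
  · rintro L (hL | hL) L' (hL' | hL') a haL haL'
    · exact h.eq_of_mem L hL.1 L' hL'.1 a haL haL'
    · exact (hne L hL a haL (hℒK L' hL' haL')).elim
    · exact (hne L' hL' a haL' (hℒK L hL haL)).elim
    · exact hℒ.eq_of_mem L hL L' hL' a haL haL'
  · rintro L (hL | hL) a ha b ⟨hbY, hb⟩ hab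
    · exact h.mem_of_adj L hL.1 a ha b ⟨hbY, fun hbB => hb (Or.inl hbB)⟩ hab
    · have hbK := h.mem_of_adj K hK a (hℒK L hL ha) b ⟨hbY, fun hbB => hb (Or.inl hbB)⟩ hab
      exact hℒ.mem_of_adj L hL a ha b
        ⟨⟨hbK, fun hbv => hb (Or.inr (Or.inl hbv))⟩, fun hbS => hb (Or.inr (Or.inr hbS))⟩ hab
  · have hdisj : Disjoint (𝒦 \ {K}) ℒ := by
      rw [Set.disjoint_left]
      intro L hL hL'
      obtain ⟨a, ha⟩ := (Set.ncard_pos (Set.toFinite _)).1 (h.odd L hL.1).pos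
      exact hne L hL a ha (hℒK L hL' ha)
    rw [Set.ncard_union_eq hdisj]
    have h1 := Set.ncard_sdiff_singleton_add_one hK (Set.toFinite 𝒦)
    have h2 := Set.ncard_insert_le v S
    omega

theorem MatchedBy.exists_apply_mem (h : OddFamily G Y B 𝒦) {Z : Set V} (hZ : Z ⊆ Y)
    (hf : MatchedBy G f Z) {K : Set V} (hK : K ∈ 𝒦) (hKZ : K ⊆ Z) : ∃ k ∈ K, f k ∈ B := by
  by_contra! hcon
  have : MatchedBy G f K := hf.restrict hKZ fun v hv =>
    h.mem_of_adj K hK v hv _ ⟨hZ (hf v (hKZ hv)).1, hcon v hv⟩ (hf v (hKZ hv)).2.2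
  exact Nat.not_even_iff_odd.2 (h.odd K hK) (Matchable.even_ncard ⟨f, this⟩ (Set.toFinite _))

/-- An odd member cannot be matched within itself, so each one uses up its own vertex of `B`. -/
theorem OddFamily.ncard_le (h : OddFamily G Y B 𝒦) {Z : Set V} (hZ : Z ⊆ Y)
    (hm : Matchable G Z) (hKZ : ∀ K ∈ 𝒦, K ⊆ Z) : 𝒦.ncard ≤ (B ∩ Z).ncard := by
  obtain ⟨f, hf⟩ := hm
  rcases 𝒦.eq_empty_or_nonempty with rfl | ⟨K₀, hK₀⟩
  · simp
  have : Nonempty V := ((Set.ncard_pos (Set.toFinite _)).1 (h.odd K₀ hK₀).pos).to_type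
  have hex : ∀ K ∈ 𝒦, ∃ k ∈ K, f k ∈ B := fun K hK =>
    MatchedBy.exists_apply_mem h hZ hf hK (hKZ K hK)
  choose! k hk hkB using hex
  refine Set.ncard_le_ncard_of_injOn (fun K => f (k K))
    (fun K hK => ⟨hkB K hK, (hf _ (hKZ K hK (hk K hK))).1⟩) ?_
  intro K hK L hL hKL
  have := hf.eq_of_apply_eq (hKZ K hK (hk K hK)) (hKZ L hL (hk L hL)) hKL
  exact h.eq_of_mem K hK L hL _ (hk K hK) (this ▸ hk L hL)

/-- A set `B` as in the Gallai–Edmonds theorem: every part of `Y \ B` is factor-critical, and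
there is one part more than `B` has vertices. -/
structure IsCriticalBarrier (G : SimpleGraph V) (Y B : Set V) (𝒦 : Set (Set V)) : Prop
    extends OddFamily G Y B 𝒦 where
  subset_left : B ⊆ Y
  ncard_eq : 𝒦.ncard = B.ncard + 1
  sUnion_eq : ⋃₀ 𝒦 = Y \ B
  matchable : ∀ K ∈ 𝒦, ∀ v ∈ K, Matchable G (K \ {v})

/-- Take `B` maximal among the sets with surplus at least one. The matching of `Y \ {g}` bounds the
surplus by one. A vertex outside `B` and the family, or a part that is not factor-critical, would
allow a larger `B`. -/
theorem exists_isCriticalBarrier {g : V} (hg : g ∈ Y) (hm : Matchable G (Y \ {g})) :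
    ∃ B 𝒦, IsCriticalBarrier G Y B 𝒦 := by
  have hYc := Set.ncard_sdiff_singleton_add_one hg (Set.toFinite Y)
  have hYe := Nat.even_iff.1 (hm.even_ncard (Set.toFinite _))
  obtain ⟨B, ⟨hBY, 𝒦, h𝒦, hle⟩, hmax⟩ := (Set.toFinite {B : Set V | B ⊆ Y ∧ ∃ 𝒦,
    OddFamily G Y B 𝒦 ∧ B.ncard + 1 ≤ 𝒦.ncard}).exists_maximal ⟨∅, by simp, {Y}, by
      refine ⟨?_, ?_, ?_, ?_⟩
      · rintro K rfl; simp
      · rintro K rfl; exact Nat.odd_iff.2 (by omega)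
      · rintro K rfl L rfl; simp
      · rintro K rfl a - b hb -; exact hb.1, by simp⟩
  -- At most one member contains `g`; the others are counted by the matching of `Y \ {g}`.
  have hub : 𝒦.ncard ≤ B.ncard + 1 := by
    have h1 := (h𝒦.mono (ℒ := {K ∈ 𝒦 | g ∉ K}) (Set.sep_subset _ _)).ncard_le
      (Set.sdiff_subset) hm fun K hK a ha => ⟨(h𝒦.subset K hK.1 ha).1, fun h => hK.2 (h ▸ ha)⟩
    have h2 : (B ∩ (Y \ {g})).ncard ≤ B.ncard := Set.ncard_le_ncard Set.inter_subset_left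
    have h3 : {K ∈ 𝒦 | g ∈ K}.ncard ≤ 1 := by
      rw [Set.ncard_le_one_iff]
      exact fun hK hL => h𝒦.eq_of_mem _ hK.1 _ hL.1 g hK.2 hL.2
    have h4 : 𝒦 ⊆ {K ∈ 𝒦 | g ∉ K} ∪ {K ∈ 𝒦 | g ∈ K} := fun K hK => by
      by_cases h : g ∈ K
      · exact Or.inr ⟨hK, h⟩
      · exact Or.inl ⟨hK, h⟩
    have h5 := Set.ncard_le_ncard h4 (Set.toFinite _)
    have h6 := Set.ncard_union_le {K ∈ 𝒦 | g ∉ K} {K ∈ 𝒦 | g ∈ K}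
    omega
  refine ⟨B, 𝒦, h𝒦, hBY, by omega, ?_, ?_⟩
  · by_contra hne
    have hne' : ((Y \ B) \ ⋃₀ 𝒦).Nonempty := by
      rw [Set.nonempty_iff_ne_empty]
      exact fun h => hne ((Set.sUnion_subset h𝒦.subset).antisymm (Set.sdiff_eq_empty.1 h))
    obtain ⟨v, ⟨hvY, hvB⟩, hv⟩ := hne'
    -- The leftover is even, so moving `v` into `B` makes it odd and turns it into a new member.
    have h1 := h𝒦.rest_ncard hBY
    have h2 : ((Y \ insert v B) \ ⋃₀ 𝒦) = ((Y \ B) \ ⋃₀ 𝒦) \ {v} := by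
      ext z
      simp only [Set.mem_sdiff, Set.mem_insert_iff, Set.mem_singleton_iff]
      tauto
    have h3 := Set.ncard_sdiff_singleton_add_one (show v ∈ (Y \ B) \ ⋃₀ 𝒦 from ⟨⟨hvY, hvB⟩, hv⟩)
      (Set.toFinite _)
    obtain ⟨h4, h5⟩ := h𝒦.insert_rest (B' := insert v B) (Set.subset_insert _ _)
      (by rw [h2]; exact Nat.odd_iff.2 (by omega)) (by
        rintro a (rfl | ha)
        · exact hv
        · exact fun ⟨K, hK, haK⟩ => (h𝒦.subset K hK haK).2 ha)
    have h6 := Set.ncard_insert_of_notMem hvB (Set.toFinite B)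
    exact hvB (hmax ⟨Set.insert_subset hvY hBY, _, h4, by omega⟩ (Set.subset_insert _ _)
      (Set.mem_insert _ _))
  · intro K hK v hv
    by_contra hn
    obtain ⟨B', hB', ⟨b, hb⟩, ℒ, hℒ, hle'⟩ := h𝒦.exists_refinement hK hv hn
    have h1 := Set.ncard_union_le B B'
    exact (hB' hb).2 (hmax ⟨Set.union_subset hBY (hB'.trans Set.sdiff_subset), ℒ, hℒ, by omega⟩
      Set.subset_union_left (Or.inr hb))

/-- If `x` were in `B`, all `B.ncard + 1` parts would lie in `Y \ {x}` and need distinct partners in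
`B`. -/
theorem IsCriticalBarrier.notMem_of_matchable (h : IsCriticalBarrier G Y B 𝒦) {x : V}
    (hm : Matchable G (Y \ {x})) : x ∉ B := by
  intro hx
  have h1 := h.ncard_le (Set.sdiff_subset) hm fun K hK a ha =>
    ⟨(h.subset K hK ha).1, fun hax => (h.subset K hK ha).2 (hax ▸ hx)⟩
  have h2 : (B ∩ (Y \ {x})).ncard ≤ B.ncard := Set.ncard_le_ncard Set.inter_subset_left
  have h3 := h.ncard_eq
  omega

/-- A perfect matching of `Y \ {g}` matches the part that contains `g` within itself, and every
other part has exactly one vertex that is matched to a vertex of the barrier. -/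
theorem IsCriticalBarrier.exits (h : IsCriticalBarrier G Y B 𝒦) {g : V} {K₀ : Set V}
    (hK₀ : K₀ ∈ 𝒦) (hg : g ∈ K₀) (hf : MatchedBy G f (Y \ {g})) :
    (∀ a ∈ K₀ \ {g}, f a ∈ K₀ \ {g}) ∧
      ∀ K ∈ 𝒦, g ∉ K → ∃ k ∈ K, f k ∈ B ∧ ∀ a ∈ K, a ≠ k → f a ∈ K := by
  have hsub : ∀ K ∈ 𝒦 \ {K₀}, K ⊆ Y \ {g} := fun K hK a ha =>
    ⟨(h.subset K hK.1 ha).1, fun hag => hK.2 (h.eq_of_mem K hK.1 K₀ hK₀ g (hag ▸ ha) hg)⟩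
  have : Nonempty V := ⟨g⟩
  have hex : ∀ K ∈ 𝒦 \ {K₀}, ∃ k ∈ K, f k ∈ B := fun K hK =>
    MatchedBy.exists_apply_mem h.toOddFamily Set.sdiff_subset hf hK.1 (hsub K hK)
  choose! k hk hkB using hex
  have hinj : Set.InjOn (fun K => f (k K)) (𝒦 \ {K₀}) := by
    intro K hK L hL hKL
    have := hf.eq_of_apply_eq (hsub K hK (hk K hK)) (hsub L hL (hk L hL)) hKL
    exact h.eq_of_mem K hK.1 L hL.1 _ (hk K hK) (this ▸ hk L hL)
  have hcard := Set.ncard_sdiff_singleton_add_one hK₀ (Set.toFinite 𝒦)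
  -- The parts other than `K₀` are as many as the vertices of `B`, so their exits exhaust `B`; no
  -- further vertex can be matched into it.
  have himage : (fun K => f (k K)) '' (𝒦 \ {K₀}) = B := by
    refine Set.eq_of_subset_of_ncard_le ?_ ?_ (Set.toFinite _)
    · rintro _ ⟨K, hK, rfl⟩
      exact hkB K hK
    · rw [hinj.ncard_image]
      have := h.ncard_eq
      omega
  have key : ∀ a ∈ Y \ {g}, f a ∈ B → ∃ L ∈ 𝒦 \ {K₀}, a = k L := by
    intro a ha hfa
    rw [← himage] at hfa
    obtain ⟨L, hL, hLa⟩ := hfa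
    exact ⟨L, hL, (hf.eq_of_apply_eq (hsub L hL (hk L hL)) ha hLa).symm⟩
  have hstay : ∀ K ∈ 𝒦, ∀ a ∈ K, a ≠ g → f a ∉ B → f a ∈ K := by
    intro K hK a ha hag hfa
    obtain ⟨h1, -, h3⟩ := hf a ⟨(h.subset K hK ha).1, hag⟩
    exact h.mem_of_adj K hK a ha _ ⟨h1.1, hfa⟩ h3
  constructor
  · rintro a ⟨ha, hag⟩
    have haY : a ∈ Y \ {g} := ⟨(h.subset K₀ hK₀ ha).1, hag⟩
    refine ⟨hstay K₀ hK₀ a ha hag fun hfa => ?_, (hf a haY).1.2⟩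
    obtain ⟨L, hL, rfl⟩ := key a haY hfa
    exact hL.2 (h.eq_of_mem L hL.1 K₀ hK₀ _ (hk L hL) ha)
  · intro K hK hgK
    have hK' : K ∈ 𝒦 \ {K₀} := ⟨hK, fun h => hgK (h ▸ hg)⟩
    refine ⟨k K, hk K hK', hkB K hK', fun a ha hne => ?_⟩
    have hag : a ≠ g := fun h => hgK (h ▸ ha)
    refine hstay K hK a ha hag fun hfa => ?_
    obtain ⟨L, hL, rfl⟩ := key a ⟨(h.subset K hK ha).1, hag⟩ hfa
    exact hne (by rw [h.eq_of_mem L hL.1 K hK _ (hk L hL) ha])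

end Tutte

/-! ### Factor-components and contractions. -/

/-- The vertex set of the factor-component of `G` that contains `v`. -/
def compSet {V : Type*} (G : SimpleGraph V) (v : V) : Set V :=
  {u | (allowedGraph G).Reachable v u}

section Components

variable {V : Type*} {G H : SimpleGraph V} {f : V → V} {a b u v : V}

theorem mem_factorComponents_iff {K : (⊤ : SimpleGraph V).Subgraph} :
    K ∈ factorComponents G ↔ ∃ v, K = inducedOn G (compSet G v) := by
  have key : ∀ v, ((allowedGraph G).connectedComponentMk v).supp = compSet G v := by
    intro v
    ext u
    rw [SimpleGraph.ConnectedComponent.mem_supp_iff, SimpleGraph.ConnectedComponent.eq]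
    exact ⟨fun h => h.symm, fun h => h.symm⟩
  constructor
  · rintro ⟨C, rfl⟩
    induction C using SimpleGraph.ConnectedComponent.ind with
    | h v => exact ⟨v, by rw [key]⟩
  · rintro ⟨v, rfl⟩
    exact ⟨_, by rw [key]⟩

theorem mem_compSet_self : v ∈ compSet G v := SimpleGraph.Reachable.refl v

theorem compSet_eq_of_mem (h : u ∈ compSet G v) : compSet G u = compSet G v := by
  have h : (allowedGraph G).Reachable v u := h
  ext w
  exact ⟨fun hw => h.trans hw, fun hw => h.symm.trans hw⟩

theorem compSet_disjoint (h : compSet G a ≠ compSet G b) : Disjoint (compSet G a) (compSet G b) :=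
  Set.disjoint_left.2 fun _ ha hb => h ((compSet_eq_of_mem ha).symm.trans (compSet_eq_of_mem hb))

theorem mem_compSet_of_adj (hu : u ∈ compSet G a) (h : (allowedGraph G).Adj u v) :
    v ∈ compSet G a :=
  SimpleGraph.Reachable.trans hu h.reachable

theorem compSet_subset {X : Set V} (hv : v ∈ X)
    (hX : ∀ a ∈ X, a ∈ compSet G v → ∀ b, (allowedGraph G).Adj a b → b ∈ X) :
    compSet G v ⊆ X := by
  intro u hu
  have hu' : (allowedGraph G).Reachable v u := hu
  rw [SimpleGraph.reachable_iff_reflTransGen] at hu'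
  suffices h : u ∈ X ∧ u ∈ compSet G v from h.1
  induction hu' with
  | refl => exact ⟨hv, mem_compSet_self⟩
  | tail h1 h2 ih =>
    obtain ⟨h3, h4⟩ := ih ((SimpleGraph.reachable_iff_reflTransGen _ _).2 h1)
    exact ⟨hX _ h3 h4 _ h2, mem_compSet_of_adj h4 h2⟩

theorem adj_of_allowedGraph_adj (h : (allowedGraph G).Adj u v) : G.Adj u v := by
  obtain ⟨M, -, hM⟩ := h
  exact hM.adj_sub

theorem MatchedBy.allowedGraph_adj (hf : MatchedBy G f Set.univ) (v : V) :
    (allowedGraph G).Adj v (f v) :=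
  allowedGraph_adj_iff.2 ⟨f, hf, rfl⟩

theorem MatchedBy.compSet (hf : MatchedBy G f Set.univ) : MatchedBy G f (compSet G v) :=
  hf.restrict (Set.subset_univ _) fun u hu => mem_compSet_of_adj hu (hf.allowedGraph_adj u)

theorem MatchedBy.notMem_compSet (hf : MatchedBy G f Set.univ) (h : u ∉ FactorPoset.compSet G v) :
    f u ∉ FactorPoset.compSet G v := fun h' =>
  h (mem_compSet_of_adj h' (hf.allowedGraph_adj u).symm)

theorem isSeparating_of_closed {X : Set V}
    (hX : ∀ a ∈ X, ∀ b, (allowedGraph G).Adj a b → b ∈ X) : IsSeparating G X := by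
  intro K hK
  obtain ⟨v, rfl⟩ := mem_factorComponents_iff.1 hK
  by_cases h : Disjoint (compSet G v) X
  · exact Or.inr h
  · obtain ⟨u, hu, huX⟩ := Set.not_disjoint_iff.1 h
    left
    change compSet G v ⊆ X
    rw [← compSet_eq_of_mem hu]
    exact compSet_subset huX fun a ha _ => hX a ha

theorem Matchable.preimage_val {Z X : Set V} (h : Matchable G Z) (hZX : Z ⊆ X) :
    Matchable (G.induce X) (Subtype.val ⁻¹' Z) := by
  classical
  obtain ⟨f, hf⟩ := h
  refine ⟨fun v => if hv : v.1 ∈ Z then ⟨f v, hZX (hf v hv).1⟩ else v, ?_⟩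
  rintro ⟨v, hvX⟩ hv
  have hv : v ∈ Z := hv
  obtain ⟨h1, h2, h3⟩ := hf v hv
  simp [hv, h1, h2, h3]

theorem connectedComponentMk_eq_iff {X : Set V} {r : V} {p q : X} :
    ((inducedOn G (compSet G r)).spanningCoe.induce X).connectedComponentMk p =
      ((inducedOn G (compSet G r)).spanningCoe.induce X).connectedComponentMk q →
    p = q ∨ (p.1 ∈ compSet G r ∧ q.1 ∈ compSet G r) := by
  rw [SimpleGraph.ConnectedComponent.eq, SimpleGraph.reachable_iff_reflTransGen]
  intro h
  induction h with
  | refl => exact Or.inl rfl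
  | tail _ h ih =>
    obtain ⟨h1, h2, -⟩ := h
    rcases ih with rfl | ih
    · exact Or.inr ⟨h1, h2⟩
    · exact Or.inr ⟨ih.1, h2⟩

theorem connectedComponentMk_eq {X : Set V} {r : V} (hr : compSet G r ⊆ X) {p q : X}
    (hp : p.1 ∈ compSet G r) (hq : q.1 ∈ compSet G r) :
    ((inducedOn G (compSet G r)).spanningCoe.induce X).connectedComponentMk p =
      ((inducedOn G (compSet G r)).spanningCoe.induce X).connectedComponentMk q := by
  have key : compSet G r ⊆ {u | ∃ h : u ∈ X,
      ((inducedOn G (compSet G r)).spanningCoe.induce X).Reachable ⟨r, hr mem_compSet_self⟩ ⟨u, h⟩} := by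
    refine compSet_subset ⟨hr mem_compSet_self, SimpleGraph.Reachable.refl _⟩ ?_
    rintro a ⟨haX, ha⟩ har b hab
    have hb := mem_compSet_of_adj har hab
    refine ⟨hr hb, ha.trans (SimpleGraph.Adj.reachable ?_)⟩
    exact ⟨har, hb, adj_of_allowedGraph_adj hab⟩
  obtain ⟨_, h1⟩ := key hp
  obtain ⟨_, h2⟩ := key hq
  exact SimpleGraph.ConnectedComponent.sound (h1.symm.trans h2)

/-- The contraction classes are `compSet G r` and single vertices. Hence `h₀` handles deletion of
the contracted vertex, and `h₁` deletion of any other, with `s` representing the contracted vertex.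
-/
theorem isFactorCritical_contraction {X : Set V} {r : V} (hr : compSet G r ⊆ X)
    (h₀ : Matchable G (X \ compSet G r))
    (h₁ : ∀ v ∈ X \ compSet G r, ∃ s ∈ compSet G r,
      Matchable G (insert s ((X \ compSet G r) \ {v}))) :
    IsFactorCritical (contraction (G.induce X)
      ((inducedOn G (compSet G r)).spanningCoe.induce X)) := by
  have transfer : ∀ Z ⊆ X, Matchable G Z →
      (∀ p ∈ Z, ∀ q ∈ Z, p ∈ compSet G r → q ∈ compSet G r → p = q) →
      Matchable (contraction (G.induce X) ((inducedOn G (compSet G r)).spanningCoe.induce X))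
        (((inducedOn G (compSet G r)).spanningCoe.induce X).connectedComponentMk ''
          (Subtype.val ⁻¹' Z)) := by
    intro Z hZX hZ hone
    have hinj : Set.InjOn
        ((inducedOn G (compSet G r)).spanningCoe.induce X).connectedComponentMk
        (Subtype.val ⁻¹' Z) := by
      intro p hp q hq hpq
      rcases connectedComponentMk_eq_iff hpq with h | ⟨h, h'⟩
      · exact h
      · exact Subtype.ext (hone p hp q hq h h')
    refine (hZ.preimage_val hZX).image _ hinj fun p hp q hq hpq => ?_
    exact SimpleGraph.map_adj_apply' hpq fun h => hpq.ne (hinj hp hq h)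
  intro w
  rw [isFactorizable_induce_iff]
  induction w using SimpleGraph.ConnectedComponent.ind with
  | h w =>
  by_cases hw : w.1 ∈ compSet G r
  · convert transfer _ Set.sdiff_subset h₀ fun p hp q _ hpr => (hp.2 hpr).elim using 1
    ext c
    induction c using SimpleGraph.ConnectedComponent.ind with
    | h c =>
    constructor
    · intro hc
      exact ⟨c, ⟨c.2, fun hcr => hc (connectedComponentMk_eq hr hcr hw)⟩, rfl⟩
    · rintro ⟨d, hd, hdc⟩ (hc : _ = _)
      rcases connectedComponentMk_eq_iff (hdc.trans hc) with rfl | h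
      · exact hd.2 hw
      · exact hd.2 h.1
  · obtain ⟨s, hs, hm⟩ := h₁ w ⟨w.2, hw⟩
    convert transfer _ ?_ hm ?_ using 1
    · ext c
      induction c using SimpleGraph.ConnectedComponent.ind with
      | h c =>
      constructor
      · intro hc
        by_cases hcr : c.1 ∈ compSet G r
        · exact ⟨⟨s, hr hs⟩, Or.inl rfl, connectedComponentMk_eq hr hs hcr⟩
        · refine ⟨c, Or.inr ⟨⟨c.2, hcr⟩, fun h => hc ?_⟩, rfl⟩
          rw [Subtype.ext h]
          rfl
      · rintro ⟨d, hd, hdc⟩ (hc : _ = _)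
        rcases connectedComponentMk_eq_iff (hdc.trans hc) with rfl | h
        · rcases hd with hd | hd
          · exact hw (hd ▸ hs)
          · exact hd.2 rfl
        · exact hw h.2
    · rintro z (rfl | hz)
      · exact hr hs
      · exact hz.1.1
    · rintro p (rfl | hp) q (rfl | hq) hpr hqr
      · rfl
      · exact (hq.1.2 hqr).elim
      · exact (hp.1.2 hpr).elim
      · exact (hp.1.2 hpr).elim

theorem yields_of_matchable {X : Set V} (hX : ∀ a ∈ X, ∀ b, (allowedGraph G).Adj a b → b ∈ X)
    (ha : compSet G a ⊆ X) (hb : compSet G b ⊆ X) (h₀ : Matchable G (X \ compSet G a))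
    (h₁ : ∀ v ∈ X \ compSet G a, ∃ s ∈ compSet G a,
      Matchable G (insert s ((X \ compSet G a) \ {v}))) :
    Yields G (inducedOn G (compSet G a)) (inducedOn G (compSet G b)) :=
  ⟨mem_factorComponents_iff.2 ⟨a, rfl⟩, mem_factorComponents_iff.2 ⟨b, rfl⟩, X,
    isSeparating_of_closed hX, Set.union_subset ha hb, isFactorCritical_contraction ha h₀ h₁⟩

end Components

/-! ### Components below others through a matched pair. -/

section Adjacent

variable {V : Type*} [Finite V] {G : SimpleGraph V} {f : V → V} {x y : V}

/-- If a vertex outside of a factor-component is joined to both ends of an edge of a perfect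
matching in that component, then the component together with the vertex is factor-critical. -/
theorem matchable_insert_compSet_diff (hf : MatchedBy G f Set.univ)
    (hx : x ∉ compSet G y) (hxy : G.Adj x y) (hxy' : G.Adj x (f y)) :
    ∀ v ∈ compSet G y, Matchable G (insert x (compSet G y \ {v})) := by
  have hY : insert x (compSet G y) \ {x} = compSet G y := by
    ext z
    simp only [Set.mem_sdiff, Set.mem_insert_iff, Set.mem_singleton_iff]
    constructor
    · tauto
    · exact fun hz => ⟨Or.inr hz, fun h => hx (h ▸ hz)⟩
  have hpm : ∀ f', MatchedBy G f' Set.univ →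
      MatchedBy G f' (insert x (compSet G y) \ {x}) := fun f' hf' => by
    rw [hY]
    exact hf'.compSet
  obtain ⟨B, 𝒦, hB⟩ := exists_isCriticalBarrier (Set.mem_insert x _) ⟨f, hpm f hf⟩
  have hxB : x ∉ B := hB.notMem_of_matchable ⟨f, hpm f hf⟩
  have hyC : y ∈ compSet G y := mem_compSet_self
  -- Exchanging the matching edge between `y` and `f y` for the one between `x` and `f y` exposes
  -- `y` instead of `x`.
  have hyB : y ∉ B := by
    refine hB.notMem_of_matchable ?_
    have h1 := hf.compSet (v := y)
    have h2 := Matchable.insert_pair ⟨f, h1.diff_pair hyC⟩ (fun h => hx h.1)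
      (fun h => h.2 (by simp)) hxy'
    convert h2 using 1
    ext z
    have h3 : x ≠ y := hxy.ne
    have h4 : f y ≠ y := (hf y trivial).2.2.ne'
    have h5 : f y ∈ compSet G y := (h1 y hyC).1
    simp only [Set.mem_sdiff, Set.mem_insert_iff, Set.mem_singleton_iff]
    constructor
    · tauto
    · rintro (rfl | rfl | h) <;> tauto
  obtain ⟨K, hK, hxK⟩ : x ∈ ⋃₀ 𝒦 := hB.sUnion_eq ▸ ⟨Set.mem_insert _ _, hxB⟩
  have hyK : y ∈ K := hB.mem_of_adj K hK x hxK y ⟨Or.inr hyC, hyB⟩ hxy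
  -- Every perfect matching preserves `K \ {x}`, so allowed edges never leave it and `K` is the
  -- whole set.
  have hCK : compSet G y ⊆ K := by
    refine compSet_subset hyK fun a ha haC b hab => ?_
    obtain ⟨f', hf', rfl⟩ := allowedGraph_adj_iff.1 hab
    exact ((hB.exits hK hxK (hpm f' hf')).1 a ⟨ha, fun h => hx (h ▸ haC)⟩).1
  have hKY : K = insert x (compSet G y) :=
    ((hB.subset K hK).trans Set.sdiff_subset).antisymm (Set.insert_subset hxK hCK)
  intro v hv
  rw [Set.insert_sdiff_singleton_comm (fun h : x = v => hx (h ▸ hv)), ← hKY]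
  exact hB.matchable K hK v (hCK hv)

theorem yields_of_adj (hf : MatchedBy G f Set.univ) (hx : x ∉ compSet G y) (hxy : G.Adj x y)
    (hxy' : G.Adj x (f y)) : Yields G (inducedOn G (compSet G x)) (inducedOn G (compSet G y)) := by
  have hdisj : Disjoint (compSet G x) (compSet G y) :=
    compSet_disjoint fun h => hx (h ▸ mem_compSet_self)
  have hX : (compSet G x ∪ compSet G y) \ compSet G x = compSet G y := by
    rw [Set.union_sdiff_left, hdisj.symm.sdiff_eq_left]
  refine yields_of_matchable (X := compSet G x ∪ compSet G y) ?_ Set.subset_union_left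
    Set.subset_union_right ?_ ?_
  · rintro a (ha | ha) b hab
    · exact Or.inl (mem_compSet_of_adj ha hab)
    · exact Or.inr (mem_compSet_of_adj ha hab)
  · rw [hX]
    exact ⟨f, hf.compSet⟩
  · rw [hX]
    exact fun v hv => ⟨x, mem_compSet_self,
      matchable_insert_compSet_diff hf hx hxy hxy' v hv⟩

end Adjacent

/-! ### Contraction of a vertex set on the same vertex type. -/

/-- The graph obtained from `G` by contracting `S` to the vertex `g`, on the same vertex type:
the other vertices of `S` become isolated. -/
def shrink {V : Type*} (G : SimpleGraph V) (S : Set V) (g : V) : SimpleGraph V :=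
  SimpleGraph.fromRel fun u v => (u ∉ S ∧ v ∉ S ∧ G.Adj u v) ∨ (u = g ∧ v ∉ S ∧ ∃ s ∈ S, G.Adj s v)

section Shrink

variable {V : Type*} {G : SimpleGraph V} {S Z : Set V} {g u v : V}

theorem shrink_adj_iff (hg : g ∈ S) (hu : u ∉ S) (hv : v ∉ S) :
    (shrink G S g).Adj u v ↔ G.Adj u v := by
  have h1 : u ≠ g := fun h => hu (h ▸ hg)
  have h2 : v ≠ g := fun h => hv (h ▸ hg)
  simp only [shrink, SimpleGraph.fromRel_adj, h1, h2, hu, hv, not_false_eq_true, true_and,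
    false_and, or_false, G.adj_comm v u, or_self]
  exact ⟨fun h => h.2, fun h => ⟨h.ne, h⟩⟩

theorem shrink_adj_left_iff (hg : g ∈ S) (hv : v ∉ S) :
    (shrink G S g).Adj g v ↔ ∃ s ∈ S, G.Adj s v := by
  have h1 : v ≠ g := fun h => hv (h ▸ hg)
  simp only [shrink, SimpleGraph.fromRel_adj, h1, h1.symm, hg, hv, not_false_eq_true, true_and,
    false_and, false_or, or_false, not_true_eq_false, ne_eq, and_false]

theorem matchable_shrink_iff (hg : g ∈ S) (hZ : Disjoint Z S) :
    Matchable (shrink G S g) Z ↔ Matchable G Z := by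
  have h : ∀ a ∈ Z, a ∉ S := fun a ha => Set.disjoint_left.1 hZ ha
  exact ⟨fun hm => hm.mono fun a ha b hb => (shrink_adj_iff hg (h a ha) (h b hb)).1,
    fun hm => hm.mono fun a ha b hb => (shrink_adj_iff hg (h a ha) (h b hb)).2⟩

theorem matchable_insert_iff (hg : g ∉ Z) :
    Matchable G (insert g Z) ↔ ∃ u ∈ Z, G.Adj g u ∧ Matchable G (Z \ {u}) := by
  constructor
  · rintro ⟨f, hf⟩
    obtain ⟨h1, h2, h3⟩ := hf g (Set.mem_insert _ _)
    refine ⟨f g, h1.resolve_left h3.ne', h3, f, ?_⟩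
    convert hf.diff_pair (Set.mem_insert g Z) using 1
    ext z
    simp only [Set.mem_sdiff, Set.mem_insert_iff, Set.mem_singleton_iff]
    constructor
    · rintro ⟨hz, hz'⟩
      exact ⟨Or.inr hz, fun h => h.elim (fun h => hg (h ▸ hz)) hz'⟩
    · tauto
  · rintro ⟨u, hu, hadj, hm⟩
    have := hm.insert_pair (fun h => hg h.1) (fun h => h.2 rfl) hadj
    rwa [Set.insert_sdiff_singleton, Set.insert_eq_of_mem hu] at this

theorem matchable_shrink_insert_iff (hg : g ∈ S) (hZ : Disjoint Z S) :
    Matchable (shrink G S g) (insert g Z) ↔ ∃ s ∈ S, Matchable G (insert s Z) := by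
  have h : ∀ a ∈ Z, a ∉ S := fun a ha => Set.disjoint_left.1 hZ ha
  have hs : ∀ s ∈ S, s ∉ Z := fun s hs hsZ => h s hsZ hs
  rw [matchable_insert_iff (hs g hg)]
  constructor
  · rintro ⟨u, hu, hadj, hm⟩
    obtain ⟨s, hsS, hsu⟩ := (shrink_adj_left_iff hg (h u hu)).1 hadj
    exact ⟨s, hsS, (matchable_insert_iff (hs s hsS)).2
      ⟨u, hu, hsu, (matchable_shrink_iff hg (hZ.mono_left Set.sdiff_subset)).1 hm⟩⟩
  · rintro ⟨s, hsS, hm⟩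
    obtain ⟨u, hu, hsu, hm⟩ := (matchable_insert_iff (hs s hsS)).1 hm
    exact ⟨u, hu, (shrink_adj_left_iff hg (h u hu)).2 ⟨s, hsS, hsu⟩,
      (matchable_shrink_iff hg (hZ.mono_left Set.sdiff_subset)).2 hm⟩

end Shrink

/-! ### A component below a given one. -/

section Minimal

variable {V : Type*} [Finite V] {G : SimpleGraph V} {f : V → V} {a b : V}

/-- If every vertex of a factor-component can be deleted together with some vertex of a second
one, then some other factor-component is below the first one. -/
theorem exists_yields_of_matchable (hf : MatchedBy G f Set.univ)
    (hab : compSet G a ≠ compSet G b)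
    (hm : ∀ x ∈ compSet G a, ∃ y ∈ compSet G b, Matchable G {x, y}ᶜ) :
    ∃ c, compSet G c ≠ compSet G a ∧
      Yields G (inducedOn G (compSet G c)) (inducedOn G (compSet G a)) := by
  have hdisj := compSet_disjoint hab
  set S := compSet G b with hS
  have hbS : b ∈ S := mem_compSet_self
  have haS : ∀ x ∈ compSet G a, x ∉ S := fun x hx => Set.disjoint_left.1 hdisj hx
  have hYb : insert b Sᶜ \ {b} = Sᶜ := by
    rw [Set.insert_sdiff_self_of_notMem (fun h : b ∈ Sᶜ => h hbS)]
  have hpm : ∀ f', MatchedBy G f' Set.univ → MatchedBy G f' Sᶜ := fun f' hf' =>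
    hf'.restrict (Set.subset_univ _) fun v hv => hf'.notMem_compSet hv
  have hpmH : ∀ f', MatchedBy G f' Set.univ →
      MatchedBy (shrink G S b) f' (insert b Sᶜ \ {b}) := fun f' hf' => by
    rw [hYb]
    exact (hpm f' hf').mono fun u hu v hv => (shrink_adj_iff hbS hu hv).2
  have hx : ∀ x ∈ compSet G a, Matchable (shrink G S b) (insert b Sᶜ \ {x}) := by
    intro x hx
    obtain ⟨y, hy, hxy⟩ := hm x hx
    have hset : (Sᶜ ∪ S \ {y}) \ {x} = {x, y}ᶜ := by
      ext z
      have h1 : z = y → z ∈ S := fun h => h ▸ hy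
      simp only [Set.mem_sdiff, Set.mem_union, Set.mem_compl_iff, Set.mem_insert_iff,
        Set.mem_singleton_iff]
      tauto
    -- The matching of G − x − y may use many vertices of `S`; the alternating path from `x` yields
    -- one that uses only `t`, as the contracted vertex permits.
    obtain ⟨t, ht, hmt⟩ := exists_matchable_insert_diff (T := S \ {y})
      (disjoint_compl_left.mono_right Set.sdiff_subset) (haS x hx) ⟨f, hpm f hf⟩
      (hset.symm ▸ hxy)
    have h1 : t ≠ x := fun h => haS x hx (h ▸ ht.1)
    have h2 : b ≠ x := fun h => haS x hx (h ▸ hbS)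
    rw [← Set.insert_sdiff_singleton_comm h1] at hmt
    rw [← Set.insert_sdiff_singleton_comm h2]
    exact (matchable_shrink_insert_iff hbS
      (disjoint_compl_left.mono_left Set.sdiff_subset)).2 ⟨t, ht.1, hmt⟩
  obtain ⟨B, 𝒦, hB⟩ := exists_isCriticalBarrier (Set.mem_insert b _) ⟨f, hpmH f hf⟩
  have hbB : b ∉ B := hB.notMem_of_matchable ⟨f, hpmH f hf⟩
  have haB : ∀ x ∈ compSet G a, x ∉ B := fun x h => hB.notMem_of_matchable (hx x h)
  have hmem : ∀ v ∈ insert b Sᶜ, v ∉ B → ∃ K ∈ 𝒦, v ∈ K := fun v hv hvB => by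
    have : v ∈ ⋃₀ 𝒦 := hB.sUnion_eq ▸ ⟨hv, hvB⟩
    exact this
  obtain ⟨K₀, hK₀, hbK₀⟩ := hmem b (Set.mem_insert _ _) hbB
  obtain ⟨K, hK, haK⟩ := hmem a (Or.inr (haS a mem_compSet_self)) (haB a mem_compSet_self)
  have haK' : compSet G a ⊆ K := by
    refine compSet_subset haK fun u hu hua v huv => ?_
    have hva := mem_compSet_of_adj hua huv
    exact hB.mem_of_adj K hK u hu v ⟨Or.inr (haS v hva), haB v hva⟩
      ((shrink_adj_iff hbS (haS u hua) (haS v hva)).2 (adj_of_allowedGraph_adj huv))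
  -- If the contracted vertex lies in `K`, undoing the contraction makes the component of `b` the
  -- lower one.
  by_cases hbK : b ∈ K
  · have hK₁ : K \ {b} ⊆ Sᶜ := fun v hv =>
      ((hB.subset K hK hv.1).1).resolve_left hv.2
    have hdiff : ((K \ {b}) ∪ S) \ S = K \ {b} := by
      rw [Set.union_sdiff_right, sdiff_eq_left]
      exact Set.disjoint_left.2 hK₁
    have hstay : ∀ f', MatchedBy G f' Set.univ → ∀ v ∈ K \ {b}, f' v ∈ K \ {b} :=
      fun f' hf' => (hB.exits hK hbK (hpmH f' hf')).1
    refine ⟨b, hab.symm, yields_of_matchable (X := (K \ {b}) ∪ S) ?_ Set.subset_union_right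
      (fun v hv => Or.inl ⟨haK' hv, fun h => haS v hv (h ▸ hbS)⟩) ?_ ?_⟩
    · rintro u (hu | hu) v huv
      · obtain ⟨f', hf', rfl⟩ := allowedGraph_adj_iff.1 huv
        exact Or.inl (hstay f' hf' u hu)
      · exact Or.inr (mem_compSet_of_adj hu huv)
    · rw [← hS, hdiff]
      exact ⟨f, (hpm f hf).restrict hK₁ (hstay f hf)⟩
    · rw [← hS, hdiff]
      intro v hv
      rw [← matchable_shrink_insert_iff hbS
        (Set.disjoint_left.2 fun u hu => hK₁ hu.1), Set.insert_sdiff_singleton_comm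
        (fun h : b = v => hv.2 h.symm), Set.insert_sdiff_singleton, Set.insert_eq_of_mem hbK]
      exact hB.matchable K hK v hv.1
  · have hKS : K ⊆ Sᶜ := fun v hv =>
      ((hB.subset K hK hv).1).resolve_left fun h => hbK (h ▸ hv)
    have hexits := fun f' hf' => (hB.exits hK₀ hbK₀ (hpmH f' hf')).2 K hK hbK
    -- The lower component is now that of the barrier vertex `f k`; it also contains the exit `k`.
    obtain ⟨k, hkK, hkB, hk⟩ := hexits f hf
    have hkc : k ∈ compSet G (f k) := (hf.allowedGraph_adj k).symm.reachable
    have hfm : MatchedBy G f (K \ compSet G (f k)) := by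
      refine hf.restrict (Set.subset_univ _) fun v hv => ⟨hk v hv.1 ?_, hf.notMem_compSet hv.2⟩
      exact fun h => hv.2 (h ▸ hkc)
    have hstay : ∀ f', MatchedBy G f' Set.univ →
        ∀ v ∈ K \ compSet G (f k), f' v ∈ K \ compSet G (f k) := by
      intro f' hf' v hv
      obtain ⟨k', hk'K, hk'B, hk'⟩ := hexits f' hf'
      by_cases hk'c : k' ∈ compSet G (f k)
      · exact ⟨hk' v hv.1 fun h => hv.2 (h ▸ hk'c), hf'.notMem_compSet hv.2⟩
      -- If the exit `k'` were outside this component, `f'` would match the remainder of `K` minus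
      -- one vertex while `f` matches all of it, against parity.
      · have hm' : MatchedBy G f' ((K \ compSet G (f k)) \ {k'}) := by
          refine hf'.restrict (Set.subset_univ _) fun u hu =>
            ⟨⟨hk' u hu.1.1 hu.2, hf'.notMem_compSet hu.1.2⟩, fun h : f' u = k' => ?_⟩
          rw [← h, (hf' u trivial).2.1] at hk'B
          exact (hB.subset K hK hu.1.1).2 hk'B
        have h1 := Nat.even_iff.1 (Matchable.even_ncard ⟨f, hfm⟩ (Set.toFinite _))
        have h2 := Nat.even_iff.1 (Matchable.even_ncard ⟨f', hm'⟩ (Set.toFinite _))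
        have h3 := Set.ncard_sdiff_singleton_add_one
          (show k' ∈ K \ compSet G (f k) from ⟨hk'K, hk'c⟩) (Set.toFinite _)
        omega
    refine ⟨f k, fun h => haB (f k) (h ▸ mem_compSet_self) hkB,
      yields_of_matchable (X := K ∪ compSet G (f k)) ?_ Set.subset_union_right
      (haK'.trans Set.subset_union_left) ?_ ?_⟩
    · intro u hu v huv
      by_cases huc : u ∈ compSet G (f k)
      · exact Or.inr (mem_compSet_of_adj huc huv)
      · obtain ⟨f', hf', rfl⟩ := allowedGraph_adj_iff.1 huv
        exact Or.inl (hstay f' hf' u ⟨hu.resolve_right huc, huc⟩).1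
    · rw [Set.union_sdiff_right]
      exact ⟨f, hfm⟩
    · rw [Set.union_sdiff_right]
      intro v hv
      -- Factor-criticality of `K` matches `K \ {v}`, possibly using many vertices of the lower
      -- component; the alternating path reduces these to one.
      obtain ⟨t, ht, hmt⟩ := exists_matchable_insert_diff (T := K ∩ compSet G (f k))
        (Set.disjoint_left.2 fun u hu hu' => hu.2 hu'.2) hv ⟨f, hfm⟩ (by
          rw [Set.sdiff_union_inter]
          exact (matchable_shrink_iff hbS
            (Set.disjoint_left.2 fun u hu => hKS hu.1)).1 (hB.matchable K hK v hv.1))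
      refine ⟨t, ht.2, ?_⟩
      rwa [Set.insert_sdiff_singleton_comm (fun h : t = v => hv.2 (h ▸ ht.2))]

end Minimal

/-! ### Adding edges without new perfect matchings. -/

section AddEdges

variable {V : Type*} {G : SimpleGraph V} {x : V}

/-- Adding edges at `x` whose deletion together with their ends leaves no factorizable graph does
not change the perfect matchings. -/
theorem allowedGraph_eq_of_not_matchable {G' : SimpleGraph V} (hle : G ≤ G')
    (hnew : ∀ u v, G'.Adj u v → ¬ G.Adj u v → u = x ∧ ¬ Matchable G {x, v}ᶜ ∨
      v = x ∧ ¬ Matchable G {x, u}ᶜ) :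
    allowedGraph G' = allowedGraph G := by
  have key : ∀ f, MatchedBy G' f Set.univ → MatchedBy G f Set.univ := by
    intro f hf
    -- A new edge used at `x` would be the only new edge of the matching, and removing its ends
    -- would leave a perfect matching in `G`.
    have hx : G.Adj x (f x) := by
      by_contra hcon
      obtain ⟨-, h2, h3⟩ := hf x trivial
      have hn : ¬ Matchable G {x, f x}ᶜ := by
        rcases hnew x (f x) h3 hcon with h | h
        · exact h.2
        · exact (h3.ne h.1.symm).elim
      refine hn ⟨f, ?_⟩
      have h4 := hf.diff_pair (Set.mem_univ x)
      rw [← Set.compl_eq_univ_sdiff] at h4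
      refine h4.mono fun u hu v hv huv => ?_
      by_contra hcon'
      rcases hnew u v huv hcon' with h | h
      · exact hu (Or.inl h.1)
      · exact hv (Or.inl h.1)
    intro v _
    obtain ⟨h1, h2, h3⟩ := hf v trivial
    refine ⟨h1, h2, ?_⟩
    by_contra hcon
    rcases hnew v (f v) h3 hcon with ⟨rfl, -⟩ | ⟨h, -⟩
    · exact hcon hx
    · rw [← h, h2] at hx
      exact hcon hx.symm
  ext u v
  rw [allowedGraph_adj_iff, allowedGraph_adj_iff]
  exact ⟨fun ⟨f, hf, h⟩ => ⟨f, key f hf, h⟩,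
    fun ⟨f, hf, h⟩ => ⟨f, hf.mono fun _ _ _ _ h => hle h, h⟩⟩

end AddEdges

end FactorPoset

/-! ### Choice of the two edges. -/

open FactorPoset

theorem mainTheorem6 {V : Type*} [Finite V] (G : SimpleGraph V)
    (hG : FactorPoset.IsFactorizable G)
    (G₁ G₂ : (⊤ : SimpleGraph V).Subgraph)
    (hG₁ : G₁ ∈ FactorPoset.factorComponents G)
    (hG₂ : G₂ ∈ FactorPoset.factorComponents G)
    (hnot : ¬ FactorPoset.Yields G G₁ G₂)
    (hmin : FactorPoset.IsMinimalComponent G G₁) :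
    ∃ x ∈ G₁.verts, ∃ y ∈ G₂.verts, ∃ z ∈ G₁.verts, ∃ w ∈ G₂.verts,
      Gᶜ.Adj x y ∧ Gᶜ.Adj z w ∧
      FactorPoset.factorComponents (G ⊔ SimpleGraph.edge x y ⊔ SimpleGraph.edge z w) =
        FactorPoset.factorComponents G ∧
      FactorPoset.Yields (G ⊔ SimpleGraph.edge x y ⊔ SimpleGraph.edge z w) G₁ G₂ := by
  obtain ⟨a, rfl⟩ := mem_factorComponents_iff.1 hG₁
  obtain ⟨b, rfl⟩ := mem_factorComponents_iff.1 hG₂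
  obtain ⟨f, hf⟩ := isFactorizable_iff.1 hG
  -- The relation is reflexive: contracting a component within itself leaves one vertex.
  have hab : compSet G a ≠ compSet G b := by
    intro h
    refine hnot ?_
    rw [← h]
    refine yields_of_matchable (X := compSet G a) (fun u hu v => mem_compSet_of_adj hu)
      subset_rfl subset_rfl ?_ ?_
    · exact ⟨f, by simp [MatchedBy]⟩
    · simp
  obtain ⟨x, hxa, hx⟩ : ∃ x ∈ compSet G a, ∀ y ∈ compSet G b, ¬ Matchable G {x, y}ᶜ := by
    by_contra! hcon
    obtain ⟨c, hc, hy⟩ := exists_yields_of_matchable hf hab hcon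
    exact hc (congrArg SimpleGraph.Subgraph.verts (hmin.2 _ hy.1 hy))
  have hdisj := compSet_disjoint hab
  have hxb : x ∉ compSet G b := Set.disjoint_left.1 hdisj hxa
  have hcx : compSet G x = compSet G a := compSet_eq_of_mem hxa
  -- If `x` has a neighbour `y` in the second component, it cannot also be adjacent to `f y`; if it
  -- has none, any `y` works.
  obtain ⟨y, hyb, hy⟩ : ∃ y ∈ compSet G b, ¬ G.Adj x (f y) := by
    by_cases h : ∃ y ∈ compSet G b, G.Adj x y
    · obtain ⟨y, hyb, hxy⟩ := h
      refine ⟨y, hyb, fun hxy' => hnot ?_⟩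
      have hcy := compSet_eq_of_mem hyb
      rw [← hcx, ← hcy]
      exact yields_of_adj hf (hcy ▸ hxb) hxy hxy'
    · exact ⟨b, mem_compSet_self, fun hb => h ⟨_, (hf.compSet b mem_compSet_self).1, hb⟩⟩
  have hcy := compSet_eq_of_mem hyb
  have hyb' : f y ∈ compSet G b := (hf.compSet y hyb).1
  have hne : ∀ v ∈ compSet G b, x ≠ v := fun v hv h => hxb (h ▸ hv)
  -- Both edges start at `x`. The end `w` is `y` when the edge to `y` is missing; otherwise it is `f
  -- y`, so that the two added edges coincide.
  have key : ∀ w ∈ compSet G b, (w = y ∨ G.Adj x y) →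
      factorComponents (G ⊔ SimpleGraph.edge x w ⊔ SimpleGraph.edge x (f y)) =
          factorComponents G ∧
        Yields (G ⊔ SimpleGraph.edge x w ⊔ SimpleGraph.edge x (f y))
          (inducedOn G (compSet G a)) (inducedOn G (compSet G b)) := by
    intro w hw hwy
    have hle : G ≤ G ⊔ SimpleGraph.edge x w ⊔ SimpleGraph.edge x (f y) :=
      le_sup_left.trans le_sup_left
    have hnew : ∀ u v, (G ⊔ SimpleGraph.edge x w ⊔ SimpleGraph.edge x (f y)).Adj u v →
        G.Adj u v ∨ u = x ∧ v ∈ compSet G b ∨ v = x ∧ u ∈ compSet G b := by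
      intro u v huv
      simp only [SimpleGraph.sup_adj, SimpleGraph.edge_adj] at huv
      rcases huv with (h | ⟨⟨rfl, rfl⟩ | ⟨rfl, rfl⟩, -⟩) | ⟨⟨rfl, rfl⟩ | ⟨rfl, rfl⟩, -⟩ <;> tauto
    have hxw : (G ⊔ SimpleGraph.edge x w ⊔ SimpleGraph.edge x (f y)).Adj x y := by
      rcases hwy with rfl | h
      · simp [SimpleGraph.edge_adj, hne w hw]
      · exact hle h
    have hxy' : (G ⊔ SimpleGraph.edge x w ⊔ SimpleGraph.edge x (f y)).Adj x (f y) := by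
      simp [SimpleGraph.edge_adj, hne _ hyb']
    generalize G ⊔ SimpleGraph.edge x w ⊔ SimpleGraph.edge x (f y) = G' at hle hnew hxw hxy'
    have hallowed : allowedGraph G' = allowedGraph G := by
      refine allowedGraph_eq_of_not_matchable (x := x) hle fun u v huv hn => ?_
      rcases hnew u v huv with h | ⟨h, hv⟩ | ⟨h, hu⟩
      · exact (hn h).elim
      · exact Or.inl ⟨h, hx v hv⟩
      · exact Or.inr ⟨h, hx u hu⟩
    have hcomp : ∀ v, compSet G' v = compSet G v := fun v => by rw [compSet, hallowed]; rfl
    -- Factor-components are induced subgraphs, so it also matters that the new edges run between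
    -- different components.
    have hind : ∀ v, inducedOn G' (compSet G' v) = inducedOn G (compSet G v) := by
      intro v
      rw [hcomp]
      refine SimpleGraph.Subgraph.ext rfl ?_
      ext p q
      refine ⟨fun ⟨hp, hq, h⟩ => ⟨hp, hq, ?_⟩, fun ⟨hp, hq, h⟩ => ⟨hp, hq, hle h⟩⟩
      rcases hnew p q h with h | ⟨rfl, h⟩ | ⟨rfl, h⟩
      · exact h
      · rw [← compSet_eq_of_mem hq, compSet_eq_of_mem h] at hp
        exact (hxb hp).elim
      · rw [← compSet_eq_of_mem hp, compSet_eq_of_mem h] at hq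
        exact (hxb hq).elim
    refine ⟨?_, ?_⟩
    · ext K
      simp only [mem_factorComponents_iff, hind]
    · rw [← hcx, ← hcy, ← hind, ← hind]
      refine yields_of_adj (hf.mono fun _ _ _ _ h => hle h) ?_ hxw hxy'
      rw [hcomp, hcy]
      exact hxb
  have hcompl : Gᶜ.Adj x (f y) := ⟨hne _ hyb', hy⟩
  by_cases hxy : G.Adj x y
  · exact ⟨x, hxa, f y, hyb', x, hxa, f y, hyb', hcompl, hcompl, key _ hyb' (Or.inr hxy)⟩
  · exact ⟨x, hxa, y, hyb, x, hxa, f y, hyb', ⟨hne y hyb, hxy⟩, hcompl, key y hyb (Or.inl rfl)⟩
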